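/- Let $q$ be a prime power and let $V$ be a finite-dimensional vector space over $\mathbb{F}_q$ equipped with a non-degenerate symplectic form, a non-degenerate quadratic form (its polar form has radical of dimension at most $1$, and the quadratic form does not vanish at any nonzero vector of that radical), or a non-degenerate Hermitian form (with respect to the automorphism of order $2$ of $\mathbb{F}_q$, so that $q$ is a square). A subspace is totally isotropic if the form (in the quadratic case, the quadratic form) vanishes identically on it. Let $\mathcal{P}$ be the corresponding classical polar space, that is, the collection of all totally isotropic subspaces of $V$, and let $d$ be its Witt index, the largest dimension of a totally isotropic subspace. Assume $d\ge 1$. Define the parameter $e$ by: $e=1$ in the symplectic case (where $\dim V=2d$); $e=1$, $0$, $2$ in the quadratic case with $\dim V=2d+1$, $2d$, $2d+2$, respectively; $e=3/2$, $1/2$ in the Hermitian case with $\dim V=2d+1$, $2d$, respectively. The points of $\mathcal{P}$ are the $1$-dimensional, and the generators of $\mathcal{P}$ the $d$-dimensional, totally isotropic subspaces. Let $M$ be the incidence matrix of $\mathcal{P}$: the real matrix with rows indexed by the generators and columns indexed by the points, whose $(U,x)$ entry is $1$ if $x\subseteq U$ and $0$ otherwise. Then \[ \operatorname{rank}_{\mathbb{R}}(M)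 = \frac{(q^{d+e-1}+1)(q^{d+e-1}-q^{e-1}+q-1)}{(q^{e-1}+1)(q-1)}. \] -/

import Mathlib

/-- A non-degenerate symplectic, quadratic or Hermitian structure on the vector space `V` over the
field `K`; it gives rise to a classical polar space.

* symplectic: a non-degenerate alternating bilinear form;
* quadratic: a quadratic form, non-degenerate in the sense valid in every characteristic (no nonzero
  vector `v` in the radical of the polar form has `Q v = 0`, and that radical has dimension at
  most `1`), so that parabolic quadrics in characteristic two are included;
* Hermitian: a non-degenerate form `b`, `σ`-semilinear in the first variable and linear in the
  second, with `b y x = σ (b x y)`, for a field automorphism `σ` of order exactly two. -/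
inductive PolarSpace (K V : Type*) [Field K] [AddCommGroup V] [Module K V] where
  | symplectic (b : V →ₗ[K] V →ₗ[K] K) (alt : b.IsAlt) (nondeg : b.Nondegenerate)
  | quadratic (Q : QuadraticForm K V) (nondeg : Q.Nondegenerate)
  | hermitian (σ : K →+* K) (invol : ∀ a, σ (σ a) = a) (ne_id : σ ≠ RingHom.id K)
      (b : V →ₛₗ[σ] V →ₗ[K] K) (herm : b.IsSymm) (nondeg : b.Nondegenerate)

namespace PolarSpace

variable {K V : Type*} [Field K] [AddCommGroup V] [Module K V]

/-- A subspace is totally isotropic if the form restricts to zero on it. -/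
def IsTotallyIsotropic (P : PolarSpace K V) (U : Submodule K V) : Prop :=
  match P with
  | symplectic b _ _ => ∀ v ∈ U, ∀ w ∈ U, b v w = 0
  | quadratic Q _ => ∀ v ∈ U, Q v = 0
  | hermitian _ _ _ b _ _ => ∀ v ∈ U, ∀ w ∈ U, b v w = 0

/-- The Witt index: the largest dimension of a totally isotropic subspace. -/
noncomputable def wittIndex (P : PolarSpace K V) : ℕ :=
  sSup {k | ∃ U : Submodule K V, P.IsTotallyIsotropic U ∧ Module.finrank K U = k}

/-- The totally isotropic subspaces of dimension `t`. -/
def Omega (P : PolarSpace K V) (t : ℕ) : Type _ :=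
  {U : Submodule K V // P.IsTotallyIsotropic U ∧ Module.finrank K U = t}

/-- The points: the one-dimensional totally isotropic subspaces. -/
abbrev Point (P : PolarSpace K V) : Type _ := P.Omega 1

/-- The generators: the totally isotropic subspaces whose dimension is the Witt index. -/
abbrev Generator (P : PolarSpace K V) : Type _ := P.Omega P.wittIndex

noncomputable instance [Finite K] [FiniteDimensional K V] (P : PolarSpace K V) (t : ℕ) :
    Fintype (P.Omega t) :=
  haveI : Finite V := Module.finite_of_finite K
  haveI : Finite (P.Omega t) :=
    Finite.of_injective (fun U => (U.1 : Set V)) fun _ _ h => Subtype.ext (SetLike.coe_injective h)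
  Fintype.ofFinite _

open Classical in
/-- The real incidence matrix: rows are indexed by the generators, columns by the points, and an
entry is `1` if the point is contained in the generator and `0` otherwise. -/
noncomputable def incidenceMatrix (P : PolarSpace K V) : Matrix P.Generator P.Point ℝ :=
  Matrix.of fun U x => if x.1 ≤ U.1 then 1 else 0

/-- `P` has parameters `q, d, e`: the field has order `q`, the Witt index is `d`, and `e` is given
by the table of the six families of classical polar spaces:

* `Sp(2d,q)`, symplectic on `V(2d,q)`: `e = 1`;
* `Ω(2d+1,q)`, parabolic quadric in `V(2d+1,q)`: `e = 1`;
* `Ω⁺(2d,q)`, hyperbolic quadric in `V(2d,q)`: `e = 0`;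
* `Ω⁻(2d+2,q)`, elliptic quadric in `V(2d+2,q)`: `e = 2`;
* `U(2d+1,q)`, Hermitian variety in `V(2d+1,q)`: `e = 3/2`;
* `U(2d,q)`, Hermitian variety in `V(2d,q)`: `e = 1/2`. -/
def HasParameters (P : PolarSpace K V) (q d : ℕ) (e : ℝ) : Prop :=
  Nat.card K = q ∧ P.wittIndex = d ∧
    match P with
    | symplectic _ _ _ => Module.finrank K V = 2 * d ∧ e = 1
    | quadratic _ _ =>
        (Module.finrank K V = 2 * d + 1 ∧ e = 1) ∨
        (Module.finrank K V = 2 * d ∧ e = 0) ∨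
        (Module.finrank K V = 2 * d + 2 ∧ e = 2)
    | hermitian _ _ _ _ _ _ =>
        (Module.finrank K V = 2 * d + 1 ∧ e = 3 / 2) ∨
        (Module.finrank K V = 2 * d ∧ e = 1 / 2)

end PolarSpace

/-!
Write `s` for the number of singular vectors on an affine line `v + K x` whose direction `x` is
singular and not orthogonal to `v`; it is `q`, `1`, `√q` in the symplectic, quadratic, Hermitian
case. Summing over such lines shows that `q |{v ∈ Uᗮ singular}| - s |Uᗮ|` is the same for all
totally isotropic `U`. Comparing `U` with a generator counts the singular vectors, hence the
points, in `Uᗮ`, and then by induction the generators through `U`. The resulting numbers depend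
only on `q`, `d` and `E = q ^ (e - 1)`.

Let `C` be the orthogonality matrix of the points, `J` the all-ones matrix and `Q = q ^ (d - 1)`.
The counts say that `Mᵀ M` is a multiple of `C + Q E`, and that `(C - Q) (C + Q E)` is a multiple
of `J`. So `C + Q E` has a single nonzero eigenvalue other than its row sum, and its trace gives
its rank.
-/

theorem ncard_mul_eq_ncard_mul {α β R : Type*} [Finite α] [Finite β] [Semiring R] {s : Set α}
    {t : Set β} (r : α → β → Prop) {m n : R} (hm : ∀ a ∈ s, ({b ∈ t | r a b}.ncard : R) = m)
    (hn : ∀ b ∈ t, ({a ∈ s | r a b}.ncard : R) = n) : (s.ncard : R) * m = t.ncard * n := by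
  classical
  have := Fintype.ofFinite α
  have := Fintype.ofFinite β
  have above : ∀ a ∈ s.toFinset, ((t.toFinset.bipartiteAbove r a).card : R) = m := fun a ha => by
    rw [← hm a (Set.mem_toFinset.1 ha), Set.ncard_eq_toFinset_card', Finset.bipartiteAbove]
    congr 2
    ext b
    simp
  have below : ∀ b ∈ t.toFinset, ((s.toFinset.bipartiteBelow r b).card : R) = n := fun b hb => by
    rw [← hn b (Set.mem_toFinset.1 hb), Set.ncard_eq_toFinset_card', Finset.bipartiteBelow]
    congr 2
    ext a
    simp
  have h := congrArg (Nat.cast : ℕ → R)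
    (Finset.sum_card_bipartiteAbove_eq_sum_card_bipartiteBelow (s := s.toFinset)
      (t := t.toFinset) r)
  rwa [Nat.cast_sum, Nat.cast_sum, Finset.sum_congr rfl above, Finset.sum_congr rfl below,
    Finset.sum_const, Finset.sum_const, nsmul_eq_mul, nsmul_eq_mul,
    ← Set.ncard_eq_toFinset_card', ← Set.ncard_eq_toFinset_card'] at h

theorem sum_ite_mem_eq_ncard {α R : Type*} [Fintype α] [NonAssocSemiring R] (s : Set α)
    [DecidablePred (· ∈ s)] : ∑ a, (if a ∈ s then 1 else 0 : R) = s.ncard := by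
  rw [Finset.sum_boole, Set.ncard_eq_toFinset_card', Set.toFinset]
  congr 2
  ext
  simp

theorem ncard_coe_submodule {K V : Type*} [Field K] [AddCommGroup V] [Module K V]
    [FiniteDimensional K V] (W : Submodule K V) :
    (W : Set V).ncard = Nat.card K ^ Module.finrank K W := by
  rw [← Module.natCard_eq_pow_finrank, ← Nat.card_coe_set_eq, SetLike.coe_sort_coe]

section MatrixRank

open Matrix

variable {n R : Type*} [Fintype n] [Field R]

theorem rank_eq_trace_of_isIdempotentElem {A : Matrix n n R} (hA : IsIdempotentElem A) :
    (A.rank : R) = A.trace := by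
  classical
  have hproj : LinearMap.IsProj (LinearMap.range A.toLin') A.toLin' :=
    (LinearMap.isProj_range_iff_isIdempotentElem _).2 (by
      rw [IsIdempotentElem, Module.End.mul_eq_comp, ← toLin'_mul, hA.eq])
  rw [← trace_toLin'_eq, hproj.trace]
  rfl

theorem rank_of_mul_self_eq_add_smul_idempotent {A F : Matrix n n R} {α γ κ : R} (hα : α ≠ 0)
    (hκ : κ ≠ 0) (hF : IsIdempotentElem F) (hAF : A * F = κ • F) (hFA : F * A = κ • F)
    (hAA : A * A = α • A + γ • F) :
    (A.rank : R) = F.trace + (A.trace - κ * F.trace) / α := by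
  set e := α⁻¹ • (A - κ • F) with he
  clear_value e
  have hA : A = α • e + κ • F := by rw [he, smul_inv_smul₀ hα, sub_add_cancel]
  have heF : e * F = 0 := by
    rw [he, smul_mul_assoc, sub_mul, hAF, smul_mul_assoc, hF.eq, sub_self, smul_zero]
  have hFe : F * e = 0 := by
    rw [he, mul_smul_comm, mul_sub, hFA, mul_smul_comm, hF.eq, sub_self, smul_zero]
  have hκF : (κ * κ) • F = (α * κ + γ) • F := by
    rw [mul_smul, ← hAF, ← mul_smul_comm, ← hAF, ← mul_assoc, hAA, add_mul, smul_mul_assoc, hAF,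
      smul_mul_assoc, hF.eq, add_smul, mul_smul]
  have hAe : A * e = α • e := by
    rw [he, mul_smul_comm, mul_sub, hAA, mul_smul_comm, hAF, smul_smul, hκF]
    module
  have hee : e * e = e := by
    nth_rw 1 [he]
    rw [smul_mul_assoc, sub_mul, smul_mul_assoc, hFe, hAe, smul_zero, sub_zero, inv_smul_smul₀ hα]
  have hidem : IsIdempotentElem (e + F) := by
    rw [IsIdempotentElem, add_mul, mul_add, mul_add, hee, heF, hFe, hF.eq, add_zero, zero_add]
  have hmul : A * (e + F) = A := by rw [mul_add, hAe, hAF, ← hA]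
  have hinv : A * (α⁻¹ • e + κ⁻¹ • F) = e + F := by
    rw [mul_add, mul_smul_comm, mul_smul_comm, hAe, hAF, inv_smul_smul₀ hα, inv_smul_smul₀ hκ]
  have hrank : A.rank = (e + F).rank :=
    le_antisymm (hmul ▸ rank_mul_le_right A (e + F)) (hinv ▸ rank_mul_le_left A _)
  rw [hrank, rank_eq_trace_of_isIdempotentElem hidem, trace_add, he, trace_smul, trace_sub,
    trace_smul, smul_eq_mul, smul_eq_mul, add_comm, inv_mul_eq_div]

theorem rank_of_isSymm_of_mul_self_eq [CharZero R] [Nonempty n] {A : Matrix n n R} {α β κ : R}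
    (hα : α ≠ 0) (hκ : κ ≠ 0) (hA : A.IsSymm) (hrow : ∀ i, ∑ j, A i j = κ)
    (hAA : A * A = α • A + β • of fun _ _ => 1) :
    (A.rank : R) = 1 + (A.trace - κ) / α := by
  set J : Matrix n n R := of fun _ _ => 1 with hJ
  set N := (Fintype.card n : R) with hN
  have hN0 : N ≠ 0 := Nat.cast_ne_zero.2 Fintype.card_ne_zero
  have hAJ : A * J = κ • J := by
    ext i j
    simp [hJ, mul_apply, hrow]
  have hJA : J * A = κ • J := by
    simpa [hA.eq, show Jᵀ = J by rw [hJ]; rfl] using congrArg transpose hAJ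
  have hJJ : J * J = N • J := by
    ext i j
    simp [hJ, hN, mul_apply]
  have htr : (N⁻¹ • J).trace = 1 := by simp [hJ, trace, ← hN, hN0]
  have hF : IsIdempotentElem (N⁻¹ • J) := by
    rw [IsIdempotentElem, smul_mul_smul_comm, hJJ, smul_smul, mul_assoc, inv_mul_cancel₀ hN0,
      mul_one]
  rw [rank_of_mul_self_eq_add_smul_idempotent hα hκ hF (γ := β * N), htr, mul_one]
  · rw [mul_smul_comm, hAJ, smul_comm]
  · rw [smul_mul_assoc, hJA, smul_comm]
  · rw [hAA, smul_smul, mul_inv_cancel_right₀ hN0]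

-- The hypothesis on `A * A` says that `(A - a) (A + c)` is a multiple of the all-ones matrix.
theorem rank_add_smul_one_of_isSymm [CharZero R] [Nonempty n] [DecidableEq n] {A : Matrix n n R}
    {a c k β : R} (hac : a + c ≠ 0) (hkc : k + c ≠ 0) (hA : A.IsSymm) (hrow : ∀ i, ∑ j, A i j = k)
    (hAA : A * A = (a - c) • A + (a * c) • (1 : Matrix n n R) + β • of fun _ _ => 1) :
    ((A + c • (1 : Matrix n n R)).rank : R) =
      1 + (A.trace + c * Fintype.card n - (k + c)) / (a + c) := by
  rw [rank_of_isSymm_of_mul_self_eq (κ := k + c) (β := β) hac hkc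
    (hA.add (isSymm_one.smul c)), trace_add, trace_smul, trace_one, smul_eq_mul]
  · intro i
    simp [Finset.sum_add_distrib, hrow, one_apply]
  · rw [add_mul, mul_add, mul_add, hAA, mul_smul_comm, smul_mul_assoc, smul_mul_smul_comm, mul_one,
      one_mul, mul_one]
    module

end MatrixRank

namespace PolarSpace

open Module Submodule

variable {K V : Type*} [Field K] [AddCommGroup V] [Module K V]

section Involution

variable {σ : K →+* K}

theorem exists_map_eq_neg_of_involution (invol : ∀ a, σ (σ a) = a) (ne_id : σ ≠ RingHom.id K) :
    ∃ θ : K, θ ≠ 0 ∧ σ θ = -θ := by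
  obtain ⟨w, hw⟩ : ∃ w, σ w ≠ w := by
    by_contra! h
    exact ne_id (RingHom.ext h)
  exact ⟨w - σ w, sub_ne_zero.2 hw.symm, by rw [map_sub, invol, neg_sub]⟩

theorem exists_add_map_eq_one_of_involution (invol : ∀ a, σ (σ a) = a)
    (ne_id : σ ≠ RingHom.id K) : ∃ a : K, a + σ a = 1 := by
  obtain ⟨a, ha⟩ : ∃ a, a + σ a ≠ 0 := by
    by_contra! h
    refine ne_id (RingHom.ext fun a => ?_)
    have two_eq_zero : (1 : K) + 1 = 0 := by simpa using h 1
    rw [RingHom.id_apply]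
    linear_combination h a - a * two_eq_zero
  refine ⟨a / (a + σ a), ?_⟩
  rw [map_div₀, map_add, invol, add_comm (σ a) a, ← add_div, div_self ha]

theorem ncard_add_map_eq (invol : ∀ a, σ (σ a) = a) (ne_id : σ ≠ RingHom.id K) {c : K}
    (hc : σ c = c) : {z | z + σ z = c}.ncard = {u | σ u = u}.ncard := by
  obtain ⟨θ, hθ0, hθ⟩ := exists_map_eq_neg_of_involution invol ne_id
  obtain ⟨a, ha⟩ := exists_add_map_eq_one_of_involution invol ne_id
  have himage : (fun u => c * a + θ * u) '' {u | σ u = u} = {z | z + σ z = c} := by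
    ext z
    constructor
    · rintro ⟨u, hu, rfl⟩
      rw [Set.mem_ofPred_eq] at hu ⊢
      rw [map_add, map_mul, map_mul, hθ, hc, hu]
      linear_combination c * ha
    · intro hz
      rw [Set.mem_ofPred_eq] at hz
      refine ⟨(z - c * a) / θ, ?_, by simp only; field_simp; ring⟩
      rw [Set.mem_ofPred_eq, map_div₀, map_sub, map_mul, hθ, hc,
        div_eq_div_iff (neg_ne_zero.2 hθ0) hθ0]
      linear_combination θ * hz - c * θ * ha
  rw [← himage, Set.ncard_image_of_injective]
  exact (add_right_injective _).comp (mul_right_injective₀ hθ0)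

theorem natCard_eq_ncard_fixed_sq [Finite K] (invol : ∀ a, σ (σ a) = a)
    (ne_id : σ ≠ RingHom.id K) : Nat.card K = {u | σ u = u}.ncard ^ 2 := by
  have h := ncard_mul_eq_ncard_mul (s := Set.univ) (t := {c | σ c = c}) (fun z c => z + σ z = c)
    (m := 1) (n := {u | σ u = u}.ncard) (fun z _ => ?_) fun c hc => ?_
  · simpa [sq] using h
  · rw [Nat.cast_id, Set.ncard_eq_one]
    refine ⟨z + σ z, Set.ext fun c => ⟨fun h => h.2.symm, ?_⟩⟩
    rintro rfl
    exact ⟨by rw [Set.mem_ofPred_eq, map_add, invol, add_comm], rfl⟩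
  · simpa using ncard_add_map_eq invol ne_id hc

end Involution

/-- The automorphism for which the form is semilinear in its first variable. -/
def conj : PolarSpace K V → (K →+* K)
  | symplectic _ _ _ => RingHom.id K
  | quadratic _ _ => RingHom.id K
  | hermitian σ _ _ _ _ _ => σ

/-- The sesquilinear form of a polar space; for a quadratic form, its polar form. -/
def form (P : PolarSpace K V) : V →ₛₗ[P.conj] V →ₗ[K] K :=
  match P with
  | symplectic b _ _ => b
  | quadratic Q _ => Q.polarBilin
  | hermitian _ _ _ b _ _ => b

/-- A vector is singular if it spans a totally isotropic subspace. -/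
def IsSingular (P : PolarSpace K V) (v : V) : Prop :=
  match P with
  | symplectic b _ _ => b v v = 0
  | quadratic Q _ => Q v = 0
  | hermitian _ _ _ b _ _ => b v v = 0

/-- The number of singular vectors on an affine line whose direction is singular and not orthogonal
to the line, see `IsSingular.ncard_add_smul`. -/
noncomputable def singularLineCount : PolarSpace K V → ℕ
  | symplectic _ _ _ => Nat.card K
  | quadratic _ _ => 1
  | hermitian σ _ _ _ _ _ => {u | σ u = u}.ncard

variable {P : PolarSpace K V}

theorem form_isRefl (P : PolarSpace K V) : P.form.IsRefl := by
  intro x y h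
  match P with
  | symplectic b alt _ => exact alt.isRefl x y h
  | quadratic Q _ => exact (QuadraticMap.polar_comm Q y x).trans h
  | hermitian σ _ _ b herm _ =>
    exact (herm.eq x y).symm.trans (by rw [show b x y = 0 from h, map_zero])

theorem isSingular_zero (P : PolarSpace K V) : P.IsSingular 0 := by
  cases P <;> simp [IsSingular]

namespace IsSingular

theorem smul {v : V} (hv : P.IsSingular v) (a : K) : P.IsSingular (a • v) := by
  cases P <;> simp_all [IsSingular, QuadraticMap.map_smul]

theorem form_self {v : V} (hv : P.IsSingular v) : P.form v v = 0 := by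
  match P with
  | symplectic _ _ _ => exact hv
  | quadratic Q _ =>
    exact (QuadraticMap.polar_self Q v).trans (by rw [show Q v = 0 from hv, smul_zero])
  | hermitian _ _ _ _ _ _ => exact hv

theorem add {v w : V} (hv : P.IsSingular v) (hw : P.IsSingular w) (h : P.form v w = 0) :
    P.IsSingular (v + w) := by
  have h' := P.form_isRefl v w h
  match P with
  | symplectic _ alt _ => exact alt (v + w)
  | quadratic Q _ =>
    simp only [IsSingular] at hv hw ⊢
    rw [QuadraticMap.map_add Q, hv, hw, show QuadraticMap.polar Q v w = 0 from h, add_zero,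
      add_zero]
  | hermitian _ _ _ b _ _ =>
    simp only [IsSingular] at hv hw ⊢
    rw [map_add, map_add, LinearMap.add_apply, LinearMap.add_apply, hv, hw,
      show b v w = 0 from h, show b w v = 0 from h', add_zero, add_zero]

theorem eq_zero_of_form_eq_zero {x : V} (hx : P.IsSingular x) (h : ∀ v, P.form x v = 0) :
    x = 0 := by
  match P with
  | symplectic _ _ nondeg => exact nondeg.1 x h
  | quadratic Q nondeg =>
    have hmem : x ∈ Q.radical := ⟨hx, LinearMap.ext h⟩
    rwa [nondeg.radical_eq_bot, mem_bot] at hmem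
  | hermitian _ _ _ _ _ nondeg => exact nondeg.1 x h

theorem add_smul_iff {x v : V} (hx : P.IsSingular x) (h : P.form x v = 0) (a : K) :
    P.IsSingular (v + a • x) ↔ P.IsSingular v := by
  have translate : ∀ {w : V} (c : K), P.form x w = 0 → P.IsSingular w → P.IsSingular (w + c • x) :=
    fun c hxw hw => hw.add (hx.smul c) (by rw [map_smul, P.form_isRefl _ _ hxw, smul_zero])
  refine ⟨fun hs => ?_, translate a h⟩
  have hxw : P.form x (v + a • x) = 0 := by
    rw [map_add, map_smul, h, hx.form_self, smul_zero, add_zero]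
  simpa using translate (-a) hxw hs

end IsSingular

theorem ncard_quadratic_add_smul_eq_zero {Q : QuadraticForm K V} {x v : V} (hx : Q x = 0)
    (h : QuadraticMap.polar Q x v ≠ 0) : {a : K | Q (v + a • x) = 0}.ncard = 1 := by
  have expand : ∀ a : K, Q (v + a • x) = Q v + a * QuadraticMap.polar Q x v := fun a => by
    rw [QuadraticMap.map_add Q, QuadraticMap.map_smul, hx, smul_zero, add_zero,
      QuadraticMap.polar_smul_right, QuadraticMap.polar_comm Q x v, smul_eq_mul]
  rw [Set.ncard_eq_one]
  refine ⟨-Q v / QuadraticMap.polar Q x v, Set.ext fun a => ?_⟩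
  rw [Set.mem_ofPred_eq, Set.mem_singleton_iff, expand, eq_div_iff h, add_comm,
    add_eq_zero_iff_eq_neg]

theorem ncard_hermitian_add_smul_eq_zero {σ : K →+* K} (invol : ∀ a, σ (σ a) = a)
    (ne_id : σ ≠ RingHom.id K) {b : V →ₛₗ[σ] V →ₗ[K] K} (herm : b.IsSymm) {x v : V}
    (hx : b x x = 0) (h : b x v ≠ 0) :
    {a : K | b (v + a • x) (v + a • x) = 0}.ncard = {u | σ u = u}.ncard := by
  have hσ : σ (b x v) ≠ 0 := (map_ne_zero σ).2 h
  have hvx : b v x = σ (b x v) := (herm.eq x v).symm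
  have expand : ∀ a : K, b (v + a • x) (v + a • x) =
      b v v + (a * σ (b x v) + σ (a * σ (b x v))) := fun a => by
    rw [map_mul σ, invol]
    simp [hx, hvx]
    ring
  have hpre : {a : K | b (v + a • x) (v + a • x) = 0} =
      (· * σ (b x v)) ⁻¹' {z | z + σ z = -b v v} := by
    ext a
    rw [Set.mem_preimage, Set.mem_ofPred_eq, Set.mem_ofPred_eq, expand, add_comm,
      add_eq_zero_iff_eq_neg]
  rw [hpre, Set.ncard_preimage_of_injective_subset_range (mul_left_injective₀ hσ)
    fun z _ => ⟨z / σ (b x v), div_mul_cancel₀ z hσ⟩,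
    ncard_add_map_eq invol ne_id (by rw [map_neg, herm.eq])]

theorem IsSingular.ncard_add_smul {x v : V} (hx : P.IsSingular x) (h : P.form x v ≠ 0) :
    {a : K | P.IsSingular (v + a • x)}.ncard = P.singularLineCount := by
  match P with
  | symplectic b alt _ =>
    have huniv : {a : K | b (v + a • x) (v + a • x) = 0} = Set.univ :=
      Set.eq_univ_of_forall fun a => alt _
    exact (congrArg Set.ncard huniv).trans (Set.ncard_univ K)
  | quadratic _ _ => exact ncard_quadratic_add_smul_eq_zero hx h
  | hermitian _ invol ne_id _ herm _ => exact ncard_hermitian_add_smul_eq_zero invol ne_id herm hx h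

/-- The orthogonal complement of a subspace. -/
abbrev perp (P : PolarSpace K V) (U : Submodule K V) : Submodule K V := U.orthogonalBilin P.form

theorem le_perp_comm {U W : Submodule K V} : U ≤ P.perp W ↔ W ≤ P.perp U :=
  ⟨fun h _ hw _ hu => P.form_isRefl _ _ (h hu _ hw),
    fun h _ hu _ hw => P.form_isRefl _ _ (h hw _ hu)⟩

theorem perp_sup (U W : Submodule K V) : P.perp (U ⊔ W) = P.perp U ⊓ P.perp W :=
  eq_of_forall_le_iff fun X => by
    rw [le_perp_comm, sup_le_iff, le_inf_iff, le_perp_comm (U := X), le_perp_comm (U := X)]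

theorem perp_bot : P.perp ⊥ = ⊤ := top_le_iff.1 (le_perp_comm.2 bot_le)

theorem mem_perp_span_singleton {x v : V} : v ∈ P.perp (span K {x}) ↔ P.form x v = 0 := by
  rw [← span_singleton_le_iff_mem, le_perp_comm, span_singleton_le_iff_mem]
  refine ⟨fun h => P.form_isRefl _ _ (h v (mem_span_singleton_self v)), fun h w hw => ?_⟩
  obtain ⟨a, rfl⟩ := mem_span_singleton.1 hw
  rw [LinearMap.map_smulₛₗ, LinearMap.smul_apply, P.form_isRefl _ _ h, smul_zero]

theorem isTotallyIsotropic_iff {U : Submodule K V} :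
    P.IsTotallyIsotropic U ↔ (∀ v ∈ U, P.IsSingular v) ∧ U ≤ P.perp U := by
  match P with
  | symplectic _ alt _ =>
    exact ⟨fun h => ⟨fun v _ => alt v, fun w hw v hv => h v hv w hw⟩,
      fun h v hv w hw => h.2 hw v hv⟩
  | quadratic Q _ =>
    refine ⟨fun h => ⟨h, fun w hw v hv => ?_⟩, fun h => h.1⟩
    change Q (v + w) - Q v - Q w = 0
    rw [h _ (U.add_mem hv hw), h v hv, h w hw, sub_zero, sub_zero]
  | hermitian _ _ _ _ _ _ =>
    exact ⟨fun h => ⟨fun v hv => h v hv v hv, fun w hw v hv => h v hv w hw⟩,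
      fun h v hv w hw => h.2 hw v hv⟩

theorem isTotallyIsotropic_bot (P : PolarSpace K V) : P.IsTotallyIsotropic ⊥ := by
  refine isTotallyIsotropic_iff.2 ⟨fun v hv => ?_, bot_le⟩
  rw [(mem_bot K).1 hv]
  exact P.isSingular_zero

theorem IsSingular.isTotallyIsotropic_span {x : V} (hx : P.IsSingular x) :
    P.IsTotallyIsotropic (span K {x}) := by
  refine isTotallyIsotropic_iff.2 ⟨fun v hv => ?_, ?_⟩
  · obtain ⟨a, rfl⟩ := mem_span_singleton.1 hv
    exact hx.smul a
  · rw [span_singleton_le_iff_mem, mem_perp_span_singleton]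
    exact hx.form_self

namespace IsTotallyIsotropic

variable {U W : Submodule K V}

theorem isSingular (hU : P.IsTotallyIsotropic U) {v : V} (hv : v ∈ U) : P.IsSingular v :=
  (isTotallyIsotropic_iff.1 hU).1 v hv

theorem le_perp (hU : P.IsTotallyIsotropic U) : U ≤ P.perp U := (isTotallyIsotropic_iff.1 hU).2

theorem sup (hU : P.IsTotallyIsotropic U) (hW : P.IsTotallyIsotropic W) (h : U ≤ P.perp W) :
    P.IsTotallyIsotropic (U ⊔ W) := by
  refine isTotallyIsotropic_iff.2 ⟨fun v hv => ?_, ?_⟩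
  · obtain ⟨u, hu, w, hw, rfl⟩ := mem_sup.1 hv
    exact (hU.isSingular hu).add (hW.isSingular hw) (le_perp_comm.1 h hw u hu)
  · rw [perp_sup]
    exact sup_le (le_inf hU.le_perp h) (le_inf (le_perp_comm.1 h) hW.le_perp)

theorem sup_span_singleton (hU : P.IsTotallyIsotropic U) {x : V} (hx : P.IsSingular x)
    (hxU : x ∈ P.perp U) : P.IsTotallyIsotropic (U ⊔ span K {x}) :=
  hU.sup hx.isTotallyIsotropic_span (le_perp_comm.1 ((span_singleton_le_iff_mem _ _).2 hxU))

end IsTotallyIsotropic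

section WittIndex

variable [FiniteDimensional K V]

theorem bddAbove_finrank_isTotallyIsotropic (P : PolarSpace K V) :
    BddAbove {k | ∃ U : Submodule K V, P.IsTotallyIsotropic U ∧ finrank K U = k} := by
  refine ⟨finrank K V, ?_⟩
  rintro k ⟨U, -, rfl⟩
  exact U.finrank_le

theorem IsTotallyIsotropic.finrank_le_wittIndex {U : Submodule K V}
    (hU : P.IsTotallyIsotropic U) : finrank K U ≤ P.wittIndex :=
  le_csSup P.bddAbove_finrank_isTotallyIsotropic ⟨U, hU, rfl⟩

theorem exists_finrank_eq_wittIndex (P : PolarSpace K V) :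
    ∃ U : Submodule K V, P.IsTotallyIsotropic U ∧ finrank K U = P.wittIndex :=
  Nat.sSup_mem (s := {k | ∃ U : Submodule K V, P.IsTotallyIsotropic U ∧ finrank K U = k})
    ⟨_, ⊥, P.isTotallyIsotropic_bot, rfl⟩ P.bddAbove_finrank_isTotallyIsotropic

end WittIndex

/-- The set of singular vectors orthogonal to a subspace. -/
def singularPerp (P : PolarSpace K V) (U : Submodule K V) : Set V :=
  {v | v ∈ P.perp U ∧ P.IsSingular v}

theorem singularPerp_sup_span_singleton (U : Submodule K V) (x : V) :
    P.singularPerp (U ⊔ span K {x}) = P.singularPerp U ∩ P.perp (span K {x}) := by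
  ext v
  simp only [singularPerp, perp_sup, mem_inf, Set.mem_inter_iff, Set.mem_ofPred_eq, SetLike.mem_coe,
    and_right_comm]

theorem IsTotallyIsotropic.subset_singularPerp {U : Submodule K V} (hU : P.IsTotallyIsotropic U) :
    (U : Set V) ⊆ P.singularPerp U :=
  fun _ hv => ⟨hU.le_perp hv, hU.isSingular hv⟩

theorem IsTotallyIsotropic.singularPerp_eq_of_finrank_eq_wittIndex [FiniteDimensional K V]
    {U : Submodule K V} (hU : P.IsTotallyIsotropic U) (hd : finrank K U = P.wittIndex) :
    P.singularPerp U = U := by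
  refine Set.Subset.antisymm (fun v hv => ?_) hU.subset_singularPerp
  have hle := (hU.sup_span_singleton hv.2 hv.1).finrank_le_wittIndex
  rw [← hd] at hle
  rw [SetLike.mem_coe, eq_of_le_of_finrank_le le_sup_left hle]
  exact mem_sup_right (mem_span_singleton_self v)

section SingularVectors

variable [Finite K] [FiniteDimensional K V] {U : Submodule K V}

theorem ncard_perp_sdiff_mul_singularLineCount {x : V} (hx : P.IsSingular x) (hxU : x ∈ P.perp U) :
    ((P.perp U : Set V) \ P.perp (span K {x})).ncard * P.singularLineCount =
      Nat.card K * (P.singularPerp U \ P.perp (span K {x})).ncard := by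
  have : Finite V := Module.finite_of_finite K
  have hxx : ∀ a : K, a • x ∈ P.perp U ⊓ P.perp (span K {x}) := fun a =>
    smul_mem _ a ⟨hxU, mem_perp_span_singleton.2 hx.form_self⟩
  rw [← Set.ncard_univ K]
  refine ncard_mul_eq_ncard_mul (fun v a => P.IsSingular (v + a • x)) (fun v hv => ?_) fun a _ => ?_
  · simpa using hx.ncard_add_smul fun h => hv.2 (mem_perp_span_singleton.2 h)
  · rw [Nat.cast_id, ← Set.ncard_image_of_injective _ (add_left_injective (a • x))]
    congr 1
    ext w
    rw [Set.image_add_right, Set.mem_preimage]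
    have hsub := neg_mem (hxx a)
    simp only [singularPerp, Set.mem_ofPred_eq, Set.mem_sdiff, SetLike.mem_coe,
      (P.perp U).add_mem_iff_left hsub.1, (P.perp (span K {x})).add_mem_iff_left hsub.2,
      neg_add_cancel_right, and_right_comm]

/-- An integer attached to a subspace which is the same for all totally isotropic subspaces, see
`IsTotallyIsotropic.excess_eq_excess_bot`. -/
noncomputable def excess (P : PolarSpace K V) (U : Submodule K V) : ℤ :=
  Nat.card K * (P.singularPerp U).ncard - (P.perp U : Set V).ncard * P.singularLineCount

theorem excess_sup_span_singleton {x : V} (hx : P.IsSingular x) (hxU : x ∈ P.perp U) :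
    P.excess (U ⊔ span K {x}) = P.excess U := by
  have : Finite V := Module.finite_of_finite K
  have singular := Set.ncard_inter_add_ncard_sdiff_eq_ncard (P.singularPerp U)
    (P.perp (span K {x}))
  have all := Set.ncard_inter_add_ncard_sdiff_eq_ncard (P.perp U : Set V) (P.perp (span K {x}))
  have outside := ncard_perp_sdiff_mul_singularLineCount hx hxU
  zify at singular all outside
  rw [excess, excess, singularPerp_sup_span_singleton, perp_sup, coe_inf]
  linear_combination
    (Nat.card K : ℤ) * singular - (P.singularLineCount : ℤ) * all + outside

theorem IsTotallyIsotropic.excess_eq_excess_bot (hU : P.IsTotallyIsotropic U) :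
    P.excess U = P.excess ⊥ := by
  classical
  have excess_span : ∀ S : Finset V, (S : Set V) ⊆ U → P.excess (span K S) = P.excess ⊥ := by
    intro S
    induction S using Finset.induction_on with
    | empty => simp
    | insert x S _ ih =>
      intro hS
      rw [Finset.coe_insert, Set.insert_subset_iff] at hS
      rw [Finset.coe_insert, span_insert, sup_comm,
        excess_sup_span_singleton (hU.isSingular hS.1), ih hS.2]
      exact fun u hu => hU.le_perp hS.1 u (span_le.2 hS.2 hu)
  obtain ⟨S, rfl⟩ := IsNoetherian.noetherian U
  exact excess_span S subset_span

theorem IsTotallyIsotropic.finrank_add_finrank_perp (hU : P.IsTotallyIsotropic U) :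
    finrank K U + finrank K (P.perp U) = finrank K V := by
  have : Finite V := Module.finite_of_finite K
  have : RingHomSurjective P.conj := ⟨Finite.surjective_of_injective P.conj.injective⟩
  set W : Submodule K (Dual K V) := U.map P.form with hW
  have hinj : Set.InjOn P.form U := by
    intro u hu u' hu' h
    rw [← sub_eq_zero]
    refine (hU.isSingular (sub_mem hu hu')).eq_zero_of_form_eq_zero fun v => ?_
    rw [map_sub, h, sub_self, LinearMap.zero_apply]
  have hrank : finrank K W = finrank K U := by
    -- The form is only semilinear on `U`, so dimensions are compared through cardinalities.
    refine Nat.pow_right_injective (Finite.one_lt_card : 1 < Nat.card K) ?_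
    simp only [← ncard_coe_submodule]
    rw [hW, map_coe, hinj.ncard_image]
  have hperp : P.perp U = W.dualCoannihilator := by
    ext v
    simp [hW, mem_dualCoannihilator]
  rw [hperp, ← hrank]
  exact Subspace.finrank_add_finrank_dualCoannihilator_eq W

theorem ncard_singularPerp_span_singleton {x y : V} (hx : P.IsSingular x) (hxy : P.form x y ≠ 0) :
    (P.singularPerp (span K {x})).ncard =
      Nat.card K * (P.singularPerp (span K {x} ⊔ span K {y})).ncard := by
  have : Finite V := Module.finite_of_finite K
  have hyx : P.form y x ≠ 0 := fun h => hxy (P.form_isRefl _ _ h)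
  rw [← Set.ncard_univ K, ← mul_one (Set.ncard _)]
  refine ncard_mul_eq_ncard_mul (fun w a => P.form y w = a * P.form y x)
    (fun w _ => ?_) fun a _ => ?_
  · rw [Nat.cast_id, Set.ncard_eq_one]
    exact ⟨P.form y w / P.form y x, Set.ext fun a => by simp [eq_div_iff hyx, eq_comm]⟩
  · rw [Nat.cast_id, ← Set.ncard_image_of_injective (P.singularPerp (span K {x} ⊔ span K {y}))
      (add_left_injective (a • x))]
    congr 1
    ext w
    rw [singularPerp_sup_span_singleton, Set.image_add_right, Set.mem_preimage, ← neg_smul]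
    simp only [singularPerp, Set.mem_inter_iff, Set.mem_ofPred_eq, SetLike.mem_coe,
      mem_perp_span_singleton, map_add, map_smul, hx.form_self, smul_eq_mul, mul_zero, add_zero,
      neg_mul, add_neg_eq_zero]
    exact and_congr_left fun _ => and_congr_right fun h => (hx.add_smul_iff h _).symm

end SingularVectors

namespace Point

theorem finrank_add (x : P.Point) {m : ℕ} (hm : P.wittIndex = m + 1) :
    finrank K x.1 + m = P.wittIndex := by
  rw [x.2.2, hm, add_comm]

variable [FiniteDimensional K V]

theorem eq_span (x : P.Point) {v : V} (hv : v ∈ x.1) (hv0 : v ≠ 0) : x.1 = span K {v} := by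
  refine (eq_of_le_of_finrank_eq ((span_singleton_le_iff_mem _ _).2 hv) ?_).symm
  rw [finrank_span_singleton hv0, x.2.2]

theorem exists_eq_span (x : P.Point) : ∃ v, v ≠ 0 ∧ P.IsSingular v ∧ x.1 = span K {v} := by
  have hbot : x.1 ≠ ⊥ := fun h => one_ne_zero (x.2.2.symm.trans (h ▸ finrank_bot K V))
  obtain ⟨v, hv, hv0⟩ := exists_mem_ne_zero_of_ne_bot hbot
  exact ⟨v, hv0, x.2.1.isSingular hv, x.eq_span hv hv0⟩

theorem finrank_sup {x y : P.Point} (h : x ≠ y) : finrank K ↥(x.1 ⊔ y.1) = 2 := by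
  obtain ⟨v, hv0, -, hy⟩ := y.exists_eq_span
  rw [hy, finrank_sup_span_singleton, x.2.2]
  exact fun hv => h (Subtype.ext ((x.eq_span hv hv0).trans hy.symm))

theorem exists_finrank_sup_add {x y : P.Point} {m : ℕ} (hm : P.wittIndex = m + 1) (hxy : x ≠ y)
    (h : x.1 ≤ P.perp y.1) : ∃ j, m = j + 1 ∧ finrank K ↥(x.1 ⊔ y.1) + j = P.wittIndex := by
  have hle := (x.2.1.sup y.2.1 h).finrank_le_wittIndex
  rw [finrank_sup hxy, hm] at hle
  refine ⟨m - 1, by omega, ?_⟩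
  rw [finrank_sup hxy, hm]
  omega

end Point

section GeneratorsAbove

variable {U : Submodule K V}

/-- The set of generators containing a subspace. -/
def generatorsAbove (P : PolarSpace K V) (U : Submodule K V) : Set P.Generator := {G | U ≤ G.1}

theorem generatorsAbove_eq_empty {W : Submodule K V} (h : ¬ U ≤ P.perp W) :
    P.generatorsAbove (U ⊔ W) = ∅ :=
  Set.eq_empty_of_forall_notMem fun G hG => h ((le_sup_left.trans hG).trans
    (le_perp_comm.1 ((le_sup_right.trans hG).trans G.2.1.le_perp)))

theorem ncard_generatorsAbove_eq_one [FiniteDimensional K V] (hU : P.IsTotallyIsotropic U)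
    (hd : finrank K U = P.wittIndex) : (P.generatorsAbove U).ncard = 1 := by
  refine Set.ncard_eq_one.2 ⟨⟨U, hU, hd⟩, Set.ext fun G => ⟨fun h => ?_, ?_⟩⟩
  · exact Subtype.ext (eq_of_le_of_finrank_eq h (hd.trans G.2.2.symm)).symm
  · rintro rfl
    exact le_refl U

end GeneratorsAbove

section Counting

variable [Finite K]

local notation "q" => (Nat.card K : ℝ)

theorem singularLineCount_pos (P : PolarSpace K V) : 0 < P.singularLineCount := by
  match P with
  | symplectic _ _ _ => exact Nat.card_pos
  | quadratic _ _ => exact one_pos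
  | hermitian σ _ _ _ _ _ => exact (Set.ncard_pos (Set.toFinite _)).2 ⟨0, map_zero σ⟩

/-- The number `q ^ (e - 1)`, see `HasParameters.orderRatio_eq`. A totally isotropic subspace of
dimension `d - 1` lies in `q * orderRatio + 1` generators. -/
noncomputable def orderRatio (P : PolarSpace K V) : ℝ :=
  P.singularLineCount * q ^ finrank K V / q ^ (2 * P.wittIndex + 1)

theorem orderRatio_pos (P : PolarSpace K V) : 0 < P.orderRatio := by
  have hq : 0 < q := Nat.cast_pos.2 Nat.card_pos
  have hs : (0 : ℝ) < P.singularLineCount := Nat.cast_pos.2 P.singularLineCount_pos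
  rw [orderRatio]
  positivity

theorem orderRatio_mul_pow (P : PolarSpace K V) :
    P.orderRatio * q ^ (2 * P.wittIndex + 1) = P.singularLineCount * q ^ finrank K V :=
  div_mul_cancel₀ _ (pow_ne_zero _ (Nat.cast_ne_zero.2 Nat.card_pos.ne'))

variable [FiniteDimensional K V] {U : Submodule K V}

theorem IsTotallyIsotropic.ncard_perp_mul_singularLineCount {j : ℕ} (hU : P.IsTotallyIsotropic U)
    (hj : finrank K U + j = P.wittIndex) :
    ((P.perp U : Set V).ncard : ℝ) * P.singularLineCount =
      q ^ (P.wittIndex + j + 1) * P.orderRatio := by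
  have hq : q ^ finrank K U ≠ 0 := pow_ne_zero _ (Nat.cast_ne_zero.2 Nat.card_pos.ne')
  have h := P.orderRatio_mul_pow
  rw [← hU.finrank_add_finrank_perp, two_mul] at h
  nth_rw 1 [← hj] at h
  rw [ncard_coe_submodule, Nat.cast_pow]
  refine mul_left_cancel₀ hq ?_
  linear_combination -h

theorem IsTotallyIsotropic.ncard_singularPerp {j : ℕ} (hU : P.IsTotallyIsotropic U)
    (hj : finrank K U + j = P.wittIndex) :
    ((P.singularPerp U).ncard : ℝ) =
      q ^ P.wittIndex + q ^ P.wittIndex * P.orderRatio * (q ^ j - 1) := by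
  obtain ⟨G, hG, hGd⟩ := P.exists_finrank_eq_wittIndex
  have hexcess := congrArg (Int.cast : ℤ → ℝ)
    (hU.excess_eq_excess_bot.trans hG.excess_eq_excess_bot.symm)
  simp only [excess] at hexcess
  push_cast at hexcess
  rw [hU.ncard_perp_mul_singularLineCount hj, hG.ncard_perp_mul_singularLineCount (j := 0) hGd,
    hG.singularPerp_eq_of_finrank_eq_wittIndex hGd, ncard_coe_submodule, hGd,
    Nat.cast_pow] at hexcess
  refine mul_left_cancel₀ (Nat.cast_ne_zero.2 Nat.card_pos.ne' : q ≠ 0) ?_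
  linear_combination hexcess

theorem IsTotallyIsotropic.ncard_singularPerp_sdiff {j : ℕ} (hU : P.IsTotallyIsotropic U)
    (hj : finrank K U + j = P.wittIndex) :
    ((P.singularPerp U \ U).ncard : ℝ) =
      (q ^ j * P.orderRatio + 1) * (q ^ P.wittIndex - q ^ finrank K U) := by
  have : Finite V := Module.finite_of_finite K
  rw [Set.cast_ncard_sdiff hU.subset_singularPerp (Set.toFinite _), hU.ncard_singularPerp hj,
    ncard_coe_submodule, Nat.cast_pow, ← hj]
  ring

theorem ncard_sdiff_mul_eq_ncard_generatorsAbove_mul {m : ℝ}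
    (hm : ∀ v ∈ P.singularPerp U \ U, ((P.generatorsAbove (U ⊔ span K {v})).ncard : ℝ) = m) :
    ((P.singularPerp U \ U).ncard : ℝ) * m =
      (P.generatorsAbove U).ncard * (q ^ P.wittIndex - q ^ finrank K U) := by
  have : Finite V := Module.finite_of_finite K
  refine ncard_mul_eq_ncard_mul (fun v G => v ∈ G.1) (fun v hv => ?_) fun G hG => ?_
  · rw [← hm v hv]
    congr 2
    ext G
    exact (sup_le_iff.trans (and_congr_right fun _ => span_singleton_le_iff_mem v G.1)).symm
  · have hset : {v ∈ P.singularPerp U \ U | v ∈ G.1} = (G.1 : Set V) \ U := by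
      ext v
      refine ⟨fun h => ⟨h.2, h.1.2⟩, fun h => ⟨⟨⟨?_, G.2.1.isSingular h.1⟩, h.2⟩, h.1⟩⟩
      exact le_perp_comm.1 (hG.trans G.2.1.le_perp) h.1
    rw [hset, Set.cast_ncard_sdiff (SetLike.coe_subset_coe.2 hG) (Set.toFinite _),
      ncard_coe_submodule, ncard_coe_submodule, G.2.2, Nat.cast_pow, Nat.cast_pow]

theorem IsTotallyIsotropic.ncard_generatorsAbove {j : ℕ} (hU : P.IsTotallyIsotropic U)
    (hj : finrank K U + j = P.wittIndex) :
    ((P.generatorsAbove U).ncard : ℝ) = ∏ i ∈ Finset.range j, (q ^ (i + 1) * P.orderRatio + 1) := by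
  induction j generalizing U with
  | zero => simp [ncard_generatorsAbove_eq_one hU hj]
  | succ j ih =>
    have hcount := ncard_sdiff_mul_eq_ncard_generatorsAbove_mul fun v hv =>
      ih (hU.sup_span_singleton hv.1.2 hv.1.1) (by
        rw [finrank_sup_span_singleton hv.2, ← hj, add_right_comm, add_assoc])
    have hne : q ^ P.wittIndex - q ^ finrank K U ≠ 0 :=
      (sub_pos.2 (pow_lt_pow_right₀ (Nat.one_lt_cast.2 Finite.one_lt_card) (by omega))).ne'
    rw [hU.ncard_singularPerp_sdiff hj] at hcount
    rw [Finset.prod_range_succ]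
    refine mul_right_cancel₀ hne ?_
    linear_combination -hcount

/-- The set of points orthogonal to a subspace. -/
def pointsPerp (P : PolarSpace K V) (U : Submodule K V) : Set P.Point := {z | z.1 ≤ P.perp U}

theorem ncard_pointsPerp (P : PolarSpace K V) (U : Submodule K V) :
    ((P.pointsPerp U).ncard : ℝ) = ((P.singularPerp U).ncard - 1) / (q - 1) := by
  have : Finite V := Module.finite_of_finite K
  have hq : q - 1 ≠ 0 := (sub_pos.2 (Nat.one_lt_cast.2 Finite.one_lt_card)).ne'
  have hzero : {0} ⊆ P.singularPerp U :=
    Set.singleton_subset_iff.2 ⟨zero_mem _, P.isSingular_zero⟩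
  have hcount := ncard_mul_eq_ncard_mul (s := P.singularPerp U \ {0}) (t := P.pointsPerp U)
    (fun v z => v ∈ z.1) (m := (1 : ℝ)) (n := q - 1) (fun v hv => ?_) fun z hz => ?_
  · rw [mul_one, Set.cast_ncard_sdiff hzero (Set.toFinite _), Set.ncard_singleton,
      Nat.cast_one] at hcount
    rw [eq_div_iff hq, hcount]
  · obtain ⟨x, hx⟩ : ∃ x : P.Point, x.1 = span K {v} :=
      ⟨⟨_, hv.1.2.isTotallyIsotropic_span, finrank_span_singleton hv.2⟩, rfl⟩
    rw [Nat.cast_eq_one, Set.ncard_eq_one]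
    refine ⟨x, Set.ext fun z => ⟨fun h => ?_, ?_⟩⟩
    · exact Subtype.ext ((z.eq_span h.2 hv.2).trans hx.symm)
    · rintro rfl
      rw [Set.mem_ofPred_eq, pointsPerp, Set.mem_ofPred_eq, hx, span_singleton_le_iff_mem]
      exact ⟨hv.1.1, mem_span_singleton_self v⟩
  · have hset : {v ∈ P.singularPerp U \ {0} | v ∈ z.1} = (z.1 : Set V) \ {0} := Set.ext fun v =>
      ⟨fun h => ⟨h.2, h.1.2⟩, fun h => ⟨⟨⟨hz h.1, z.2.1.isSingular h.1⟩, h.2⟩, h.1⟩⟩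
    rw [hset, Set.cast_ncard_sdiff (Set.singleton_subset_iff.2 (zero_mem _)) (Set.toFinite _),
      ncard_coe_submodule, z.2.2, pow_one, Set.ncard_singleton, Nat.cast_one]

theorem IsTotallyIsotropic.ncard_pointsPerp {j : ℕ} (hU : P.IsTotallyIsotropic U)
    (hj : finrank K U + j = P.wittIndex) :
    ((P.pointsPerp U).ncard : ℝ) =
      (q ^ P.wittIndex - 1 + q ^ P.wittIndex * P.orderRatio * (q ^ j - 1)) / (q - 1) := by
  rw [P.ncard_pointsPerp, hU.ncard_singularPerp hj, sub_add_eq_add_sub]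

theorem natCard_point (P : PolarSpace K V) :
    (Nat.card P.Point : ℝ) =
      (q ^ P.wittIndex - 1) * (q ^ P.wittIndex * P.orderRatio + 1) / (q - 1) := by
  have huniv : P.pointsPerp ⊥ = Set.univ :=
    Set.eq_univ_of_forall fun z => le_top.trans_eq perp_bot.symm
  rw [← Set.ncard_univ, ← huniv, P.isTotallyIsotropic_bot.ncard_pointsPerp
    (by rw [finrank_bot, zero_add])]
  ring

theorem ncard_pointsPerp_sup_of_not_le_perp {m : ℕ} (hm : P.wittIndex = m + 1) {x y : P.Point}
    (h : ¬ x.1 ≤ P.perp y.1) :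
    ((P.pointsPerp (x.1 ⊔ y.1)).ncard : ℝ) =
      (q ^ m - 1) * (q ^ m * P.orderRatio + 1) / (q - 1) := by
  obtain ⟨v, -, hv, hx⟩ := x.exists_eq_span
  obtain ⟨w, -, -, hy⟩ := y.exists_eq_span
  have hvw : P.form v w ≠ 0 := fun h0 => h <| by
    rw [hx, hy, le_perp_comm, span_singleton_le_iff_mem, mem_perp_span_singleton]
    exact h0
  have hq : q ≠ 0 := Nat.cast_ne_zero.2 Nat.card_pos.ne'
  have hcount := congrArg (Nat.cast : ℕ → ℝ) (ncard_singularPerp_span_singleton hv hvw)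
  rw [Nat.cast_mul, ← hx, ← hy, x.2.1.ncard_singularPerp (x.finrank_add hm),
    hm, pow_succ] at hcount
  rw [P.ncard_pointsPerp]
  congr 1
  refine mul_left_cancel₀ hq ?_
  linear_combination -hcount

end Counting

section IncidenceMatrix

open Matrix

open Classical in
/-- The real matrix of the orthogonality relation on the points. -/
noncomputable def perpMatrix (P : PolarSpace K V) : Matrix P.Point P.Point ℝ :=
  of fun x y => if x.1 ≤ P.perp y.1 then 1 else 0

theorem perpMatrix_of_le {x y : P.Point} (h : x.1 ≤ P.perp y.1) : P.perpMatrix x y = 1 := if_pos h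

theorem perpMatrix_of_not_le {x y : P.Point} (h : ¬ x.1 ≤ P.perp y.1) : P.perpMatrix x y = 0 :=
  if_neg h

theorem perpMatrix_isSymm (P : PolarSpace K V) : P.perpMatrix.IsSymm := by
  ext x y
  by_cases h : x.1 ≤ P.perp y.1
  · exact (perpMatrix_of_le (le_perp_comm.1 h)).trans (perpMatrix_of_le h).symm
  · exact (perpMatrix_of_not_le (h ∘ le_perp_comm.1)).trans (perpMatrix_of_not_le h).symm

variable [Finite K] [FiniteDimensional K V]

local notation "q" => (Nat.card K : ℝ)

theorem sum_perpMatrix (x : P.Point) : ∑ y, P.perpMatrix x y = (P.pointsPerp x.1).ncard := by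
  classical
  rw [← sum_ite_mem_eq_ncard, ← P.perpMatrix_isSymm.eq]
  rfl

theorem trace_perpMatrix (P : PolarSpace K V) : P.perpMatrix.trace = Fintype.card P.Point := by
  simp [trace, fun x : P.Point => perpMatrix_of_le x.2.1.le_perp]

theorem perpMatrix_mul_self_apply (x y : P.Point) :
    (P.perpMatrix * P.perpMatrix) x y = (P.pointsPerp (x.1 ⊔ y.1)).ncard := by
  classical
  rw [← sum_ite_mem_eq_ncard, mul_apply]
  nth_rw 1 [← P.perpMatrix_isSymm.eq]
  simp [perpMatrix, pointsPerp, perp_sup, ← ite_and, and_comm]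

theorem transpose_incidenceMatrix_mul_self_apply (x y : P.Point) :
    (P.incidenceMatrixᵀ * P.incidenceMatrix) x y = (P.generatorsAbove (x.1 ⊔ y.1)).ncard := by
  classical
  rw [← sum_ite_mem_eq_ncard, mul_apply]
  simp [incidenceMatrix, generatorsAbove, ← ite_and, and_comm]

variable {m : ℕ}

theorem perpMatrix_mul_self [DecidableEq P.Point] (hm : P.wittIndex = m + 1) :
    P.perpMatrix * P.perpMatrix =
      (q ^ m - q ^ m * P.orderRatio) • P.perpMatrix +
        (q ^ m * (q ^ m * P.orderRatio)) • (1 : Matrix P.Point P.Point ℝ) +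
          ((q ^ m - 1) * (q ^ m * P.orderRatio + 1) / (q - 1)) • of fun _ _ => 1 := by
  have hq : q - 1 ≠ 0 := (sub_pos.2 (Nat.one_lt_cast.2 Finite.one_lt_card)).ne'
  ext x y
  simp only [perpMatrix_mul_self_apply, Matrix.smul_apply, Matrix.add_apply, smul_eq_mul, of_apply]
  by_cases h : x.1 ≤ P.perp y.1
  · rw [perpMatrix_of_le h]
    by_cases hxy : x = y
    · subst hxy
      rw [sup_idem, x.2.1.ncard_pointsPerp (x.finrank_add hm), hm, one_apply_eq]
      field_simp
      ring
    · obtain ⟨j, rfl, hj⟩ := Point.exists_finrank_sup_add hm hxy h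
      rw [(x.2.1.sup y.2.1 h).ncard_pointsPerp hj, hm, one_apply_ne hxy]
      field_simp
      ring
  · have hxy : x ≠ y := fun hxy => h (hxy ▸ x.2.1.le_perp)
    rw [perpMatrix_of_not_le h, ncard_pointsPerp_sup_of_not_le_perp hm h, one_apply_ne hxy]
    ring

theorem transpose_incidenceMatrix_mul_self [DecidableEq P.Point] (hm : P.wittIndex = m + 1) :
    (q ^ m * P.orderRatio + 1) • (P.incidenceMatrixᵀ * P.incidenceMatrix) =
      (∏ i ∈ Finset.range m, (q ^ (i + 1) * P.orderRatio + 1)) •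
        (P.perpMatrix + (q ^ m * P.orderRatio) • (1 : Matrix P.Point P.Point ℝ)) := by
  ext x y
  simp only [Matrix.smul_apply, Matrix.add_apply, smul_eq_mul,
    transpose_incidenceMatrix_mul_self_apply]
  by_cases h : x.1 ≤ P.perp y.1
  · rw [perpMatrix_of_le h]
    by_cases hxy : x = y
    · subst hxy
      rw [sup_idem, x.2.1.ncard_generatorsAbove (x.finrank_add hm), one_apply_eq]
      ring
    · obtain ⟨j, rfl, hj⟩ := Point.exists_finrank_sup_add hm hxy h
      rw [(x.2.1.sup y.2.1 h).ncard_generatorsAbove hj, one_apply_ne hxy, Finset.prod_range_succ]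
      ring
  · have hxy : x ≠ y := fun hxy => h (hxy ▸ x.2.1.le_perp)
    rw [perpMatrix_of_not_le h, generatorsAbove_eq_empty h, one_apply_ne hxy, Set.ncard_empty,
      Nat.cast_zero]
    ring

theorem rank_incidenceMatrix_eq_rank_perpMatrix_add [DecidableEq P.Point]
    (hm : P.wittIndex = m + 1) :
    P.incidenceMatrix.rank =
      (P.perpMatrix + (q ^ m * P.orderRatio) • (1 : Matrix P.Point P.Point ℝ)).rank := by
  have hE := P.orderRatio_pos
  have hleft : q ^ m * P.orderRatio + 1 ≠ 0 := by positivity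
  have hright : ∏ i ∈ Finset.range m, (q ^ (i + 1) * P.orderRatio + 1) ≠ 0 :=
    Finset.prod_ne_zero_iff.2 fun i _ => by positivity
  rw [← rank_transpose_mul_self, ← rank_smul_of_mem_nonZeroDivisors _
    (mem_nonZeroDivisors_of_ne_zero hleft), transpose_incidenceMatrix_mul_self hm,
    rank_smul_of_mem_nonZeroDivisors _ (mem_nonZeroDivisors_of_ne_zero hright)]

theorem rank_incidenceMatrix (P : PolarSpace K V) (hd : 1 ≤ P.wittIndex) :
    (P.incidenceMatrix.rank : ℝ) =
      (q ^ P.wittIndex * P.orderRatio + 1) *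
          (q ^ P.wittIndex * P.orderRatio - P.orderRatio + q - 1) /
        ((P.orderRatio + 1) * (q - 1)) := by
  classical
  obtain ⟨m, hm⟩ : ∃ m, P.wittIndex = m + 1 := Nat.exists_eq_add_of_le' hd
  have hE := P.orderRatio_pos
  have hq : 1 < q := Nat.one_lt_cast.2 Finite.one_lt_card
  have hq1 : 0 < q - 1 := sub_pos.2 hq
  have hcard : (Fintype.card P.Point : ℝ) = _ := Fintype.card_eq_nat_card ▸ P.natCard_point
  have hrow : ∀ x : P.Point, ∑ y, P.perpMatrix x y = _ := fun x =>
    (sum_perpMatrix x).trans (x.2.1.ncard_pointsPerp (x.finrank_add hm))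
  have hqm : 0 ≤ q ^ m - 1 := sub_nonneg.2 (one_le_pow₀ hq.le)
  have hqd : 0 < q ^ P.wittIndex - 1 := sub_pos.2 (one_lt_pow₀ hq (by omega))
  have : Nonempty P.Point := by
    rw [← Fintype.card_pos_iff, ← Nat.cast_pos (α := ℝ), hcard]
    positivity
  rw [rank_incidenceMatrix_eq_rank_perpMatrix_add hm, rank_add_smul_one_of_isSymm (by positivity)
    (by positivity) P.perpMatrix_isSymm hrow (perpMatrix_mul_self hm), trace_perpMatrix, hcard, hm]
  field_simp
  ring

end IncidenceMatrix

end PolarSpace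

theorem PolarSpace.HasParameters.orderRatio_eq {K V : Type*} [Field K] [Finite K] [AddCommGroup V]
    [Module K V] {P : PolarSpace K V} {q d : ℕ} {e : ℝ} (hP : P.HasParameters q d e) :
    P.orderRatio = (q : ℝ) ^ (e - 1) := by
  obtain ⟨rfl, rfl, h⟩ := hP
  have hq : (0 : ℝ) < Nat.card K := Nat.cast_pos.2 Nat.card_pos
  suffices hcount : ∃ t : ℝ, (P.singularLineCount : ℝ) = (Nat.card K : ℝ) ^ t ∧
      t + Module.finrank K V = e + 2 * P.wittIndex by
    obtain ⟨t, ht, hdim⟩ := hcount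
    rw [orderRatio, ht, ← Real.rpow_natCast, ← Real.rpow_natCast, ← Real.rpow_add hq,
      ← Real.rpow_sub hq, hdim]
    congr 1
    push_cast
    ring
  match P with
  | symplectic _ _ _ =>
    obtain ⟨hn, rfl⟩ := h
    exact ⟨1, (Real.rpow_one _).symm, by rw [hn]; push_cast; ring⟩
  | quadratic _ _ =>
    refine ⟨0, Nat.cast_one.trans (Real.rpow_zero _).symm, ?_⟩
    rcases h with ⟨hn, rfl⟩ | ⟨hn, rfl⟩ | ⟨hn, rfl⟩ <;> rw [hn] <;> push_cast <;> ring
  | hermitian σ invol ne_id _ _ _ =>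
    refine ⟨1 / 2, ?_, ?_⟩
    · rw [natCard_eq_ncard_fixed_sq invol ne_id, ← Real.sqrt_eq_rpow, Nat.cast_pow,
        Real.sqrt_sq (Nat.cast_nonneg _)]
      rfl
    · rcases h with ⟨hn, rfl⟩ | ⟨hn, rfl⟩ <;> rw [hn] <;> push_cast <;> ring

theorem lemma2p3 {K V : Type*} [Field K] [Finite K] [AddCommGroup V] [Module K V]
    [FiniteDimensional K V] (P : PolarSpace K V) (q d : ℕ) (e : ℝ) (hd : 1 ≤ d)
    (hP : P.HasParameters q d e) :
    (P.incidenceMatrix.rank : ℝ) =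
      (((q : ℝ) ^ ((d : ℝ) + e - 1) + 1) *
        ((q : ℝ) ^ ((d : ℝ) + e - 1) - (q : ℝ) ^ (e - 1) + (q : ℝ) - 1)) /
      (((q : ℝ) ^ (e - 1) + 1) * ((q : ℝ) - 1)) := by
  have hE := hP.orderRatio_eq
  obtain ⟨rfl, rfl, -⟩ := hP
  rw [add_sub_assoc, Real.rpow_add (Nat.cast_pos.2 Nat.card_pos), Real.rpow_natCast, ← hE]
  exact P.rank_incidenceMatrix hd
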